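/- Let $G$ be a locally compact group with neutral element $e$, and let $\mathcal P(G)$ be the set of continuous functions $\varphi:G\to\mathbb C$ that are positive definite, i.e. all matrices $[\varphi(u_k^{-1}u_l)]_{k,l=1}^m$ with $u_1,\dots,u_m\in G$ are positive semidefinite. For $d\in\mathbb N=\{1,2,\dots\}$ let $\mathbb S^d$ be the unit sphere of $\mathbb R^{d+1}$ and let $\mathcal P(\mathbb S^d,G)$ be the set of continuous functions $f:[-1,1]\times G\to\mathbb C$ such that all matrices $[f(\xi_k\cdot\xi_l,u_k^{-1}u_l)]_{k,l=1}^m$ with $(\xi_1,u_1),\dots,(\xi_m,u_m)\in\mathbb S^d\times G$ are positive semidefinite; put $\mathcal P(\mathbb S^\infty,G)=\bigcap_{d\ge1}\mathcal P(\mathbb S^d,G)$. Let $c_n(1,x)=T_n(x)$ be the Chebyshev polynomials of the first kind and, for $d\ge2$, let $c_n(d,x)=C_n^{(\lambda)}(x)/C_n^{(\lambda)}(1)$ with $\lambda=(d-1)/2$, where the Gegenbauer polynomials $C_n^{(\lambda)}$ are given by $(1-2xr+r^2)^{-\lambda}=\sum_{n\ge0}C_n^{(\lambda)}(x)r^n$.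 A sequence $(\varphi_{n,d})_{n\ge0}$ from $\mathcal P(G)$ with $\sum_n\varphi_{n,d}(e)<\infty$ and $$f(\cos\theta,u)=\sum_{n=0}^\infty\varphi_{n,d}(u)\,c_n(d,\cos\theta),\qquad \theta\in[0,\pi],\ u\in G,$$ is called a sequence of $d$-Schoenberg functions for $f$. **Theorem.** Let $f:[-1,1]\times G\to\mathbb C$ be continuous. Then $f\in\mathcal P(\mathbb S^\infty,G)$ if and only if there is a sequence $(\varphi_n)_{n\ge0}$ from $\mathcal P(G)$ with $\sum_n\varphi_n(e)<\infty$ such that $$f(\cos\theta,u)=\sum_{n=0}^\infty\varphi_n(u)\cos^n\theta,\qquad \theta\in[0,\pi],\ u\in G.$$ For every such sequence $(\varphi_n)$, the series converges uniformly for $(\theta,u)\in[0,\pi]\times G$. Moreover, for each $d\in\mathbb N$ the function $f$ then has exactly one sequence $(\varphi_{n,d})_{n\ge0}$ of $d$-Schoenberg functions, and $$\lim_{d\to\infty}\varphi_{n,d}(u)=\varphi_n(u)\qquad\text{for all } n\ge0,\ u\in G.$$ -/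

import Mathlib

open scoped ComplexOrder

noncomputable section

namespace SchoenbergProduct

/-- The class `𝒫(G)` of continuous positive definite functions `φ : G → ℂ`: all matrices
`[φ(u_k⁻¹ u_l)]` are positive semidefinite. -/
def PosDefFun (G : Type*) [Group G] [TopologicalSpace G] : Set (G → ℂ) :=
  {φ | Continuous φ ∧ ∀ (n : ℕ) (u : Fin n → G),
    (Matrix.of fun k l : Fin n => φ ((u k)⁻¹ * u l)).PosSemidef}

/-- The unit sphere `𝕊^d` of `ℝ^(d+1)`. -/
abbrev Sphere (d : ℕ) : Set (EuclideanSpace ℝ (Fin (d + 1))) :=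
  Metric.sphere 0 1

/-- The class `𝒫(𝕊^d, G)` of continuous `f : [-1,1] × G → ℂ` such that all matrices
`[f(ξ_k · ξ_l, u_k⁻¹ u_l)]`, `ξ_k ∈ 𝕊^d`, `u_k ∈ G`, are positive semidefinite.
A function on `[-1,1] × G` is represented by a function on `ℝ × G`, of which only the values
on `[-1,1] × G` matter. -/
def SpherePosDef (d : ℕ) (G : Type*) [Group G] [TopologicalSpace G] : Set (ℝ × G → ℂ) :=
  {f | ContinuousOn f (Set.Icc (-1) 1 ×ˢ Set.univ) ∧
    ∀ (n : ℕ) (ξ : Fin n → Sphere d) (u : Fin n → G),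
      (Matrix.of fun k l : Fin n =>
        f (inner ℝ (ξ k).1 (ξ l).1, (u k)⁻¹ * u l)).PosSemidef}

/-- The class `𝒫(𝕊^∞, G) = ⋂_{d ≥ 1} 𝒫(𝕊^d, G)`. -/
def SphereInfPosDef (G : Type*) [Group G] [TopologicalSpace G] : Set (ℝ × G → ℂ) :=
  ⋂ (d : ℕ) (_ : 1 ≤ d), SpherePosDef d G

/-- The value at `x` of the Gegenbauer polynomial `C_n^(λ)`, `λ > 0`: the coefficient of `r^n` in
the Taylor expansion at `r = 0` of the generating function `(1 - 2xr + r²)^(-λ)`. -/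
def gegenbauer (lam : ℝ) (n : ℕ) (x : ℝ) : ℝ :=
  iteratedDeriv n (fun r : ℝ => (1 - 2 * x * r + r ^ 2) ^ (-lam)) 0 / (n.factorial : ℝ)

/-- The ultraspherical polynomial `c_n(d, x)` of `𝕊^d`, `d ≥ 1`, normalized by `c_n(d, 1) = 1`:
the Chebyshev polynomial `T_n` for `d = 1`, and `C_n^(λ)(x) / C_n^(λ)(1)` with `λ = (d - 1) / 2`
for `d ≥ 2`. -/
def ultraspherical (d n : ℕ) (x : ℝ) : ℝ :=
  if d = 1 then (Polynomial.Chebyshev.T ℝ (n : ℤ)).eval x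
  else gegenbauer (((d : ℝ) - 1) / 2) n x / gegenbauer (((d : ℝ) - 1) / 2) n 1

/-- `ψ = (φ_{n,d})_n` is a sequence of `d`-Schoenberg functions for `f`: `φ_{n,d} ∈ 𝒫(G)`,
`∑ φ_{n,d}(e) < ∞`, and `f(cos θ, u) = ∑ φ_{n,d}(u) c_n(d, cos θ)`. -/
def IsSchoenbergSeq {G : Type*} [Group G] [TopologicalSpace G]
    (d : ℕ) (f : ℝ × G → ℂ) (ψ : ℕ → G → ℂ) : Prop :=
  (∀ n, ψ n ∈ PosDefFun G) ∧ Summable (fun n => ψ n 1) ∧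
    ∀ θ ∈ Set.Icc 0 Real.pi, ∀ u : G,
      HasSum (fun n => ψ n u * (ultraspherical d n (Real.cos θ) : ℂ)) (f (Real.cos θ, u))

/-- `φ_n ∈ 𝒫(G)`, `∑ φ_n(e) < ∞`, and `f(cos θ, u) = ∑ φ_n(u) cos^n θ`. -/
def IsPowerExpansion {G : Type*} [Group G] [TopologicalSpace G]
    (f : ℝ × G → ℂ) (φ : ℕ → G → ℂ) : Prop :=
  (∀ n, φ n ∈ PosDefFun G) ∧ Summable (fun n => φ n 1) ∧
    ∀ θ ∈ Set.Icc 0 Real.pi, ∀ u : G,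
      HasSum (fun n => φ n u * (Real.cos θ : ℂ) ^ n) (f (Real.cos θ, u))

end SchoenbergProduct

end

noncomputable section

namespace SchoenbergProduct

/-! A power expansion is positive definite on every sphere by Schur's product theorem: entrywise
powers of a Gram matrix stay positive semidefinite, and so do limits.

For the converse, restrict `f` to the vertices of a cube inscribed in the sphere. They form the
group {±1}^N, and the inner product of two vertices is the mean of the coordinates of their product.
Fourier analysis on this finite group makes every Walsh coefficient of `f (mean ε, ·)` positive
definite on `G` (`isPosDef_walsh`). The expectation of `f (mean ε, u)` over independent signs of
expectation `x` is the `N`-th Bernstein polynomial of `f (·, u)`; expanding ∏ (1 + ε_i x) / 2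
exhibits its coefficients as positive combinations of Walsh coefficients. At `x = 1`, `u = e` these
coefficients are nonnegative with bounded sum, so compactness yields limits φ_k, and Bernstein's
theorem identifies their power series with `f`.

For fixed `d`, x^m is a convex combination of the c_n(d, x), n ≤ m, with weights `connCoeff`.
Substituting this into the power series gives Schoenberg functions; orthogonality for the weight
sin^(d-1) θ makes them unique. As d → ∞ the weights concentrate at n = m, and dominated convergence
gives the limit. -/

/-- A pointwise limit of positive semidefinite matrices is positive semidefinite. -/
theorem posSemidef_of_tendsto {ι α : Type*} [Fintype ι] {l : Filter α} [l.NeBot]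
    {M : α → Matrix ι ι ℂ} {A : Matrix ι ι ℂ} (hM : ∀ a, (M a).PosSemidef)
    (h : ∀ i j, Filter.Tendsto (fun a => M a i j) l (nhds (A i j))) : A.PosSemidef := by
  rw [Matrix.posSemidef_iff_dotProduct_mulVec]
  constructor
  · ext i j
    have h1 : Filter.Tendsto (fun a => star (M a j i)) l (nhds (star (A j i))) := (h j i).star
    have h2 : (fun a => star (M a j i)) = fun a => M a i j := by
      funext a
      exact (hM a).isHermitian.apply i j
    rw [h2] at h1
    exact tendsto_nhds_unique h1 (h i j)
  · intro x
    have : Filter.Tendsto (fun a => star x ⬝ᵥ (M a).mulVec x) l (nhds (star x ⬝ᵥ A.mulVec x)) := by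
      simp only [dotProduct, Matrix.mulVec]
      exact tendsto_finsetSum _ fun i _ => tendsto_const_nhds.mul
        (tendsto_finsetSum _ fun j _ => (h i j).mul tendsto_const_nhds)
    exact ge_of_tendsto' this fun a => (hM a).dotProduct_mulVec_nonneg x

/-! ### Positive definite functions and the easy direction -/

/-- Positive definiteness of a function on a group, without continuity. -/
def IsPosDef {G : Type*} [Group G] (φ : G → ℂ) : Prop :=
  ∀ (n : ℕ) (u : Fin n → G), (Matrix.of fun k l : Fin n => φ ((u k)⁻¹ * u l)).PosSemidef

namespace IsPosDef

variable {G : Type*} [Group G]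

theorem of_tendsto {α : Type*} {l : Filter α} [l.NeBot] {φ : α → G → ℂ} {ψ : G → ℂ}
    (hφ : ∀ a, IsPosDef (φ a)) (h : ∀ u, Filter.Tendsto (fun a => φ a u) l (nhds (ψ u))) :
    IsPosDef ψ := fun n u =>
  posSemidef_of_tendsto (l := l) (fun a => hφ a n u) fun _ _ => h _

theorem sum {ι : Type*} (s : Finset ι) {φ : ι → G → ℂ} (hφ : ∀ i ∈ s, IsPosDef (φ i)) :
    IsPosDef (fun u => ∑ i ∈ s, φ i u) := by
  intro n u
  have := Matrix.posSemidef_sum s fun i hi => hφ i hi n u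
  convert this using 1
  ext k l
  simp [Matrix.sum_apply]

theorem mul_ofReal {φ : G → ℂ} (hφ : IsPosDef φ) {c : ℝ} (hc : 0 ≤ c) :
    IsPosDef (fun u => φ u * (c : ℂ)) := by
  intro n u
  have := (hφ n u).smul (a := (c : ℂ)) (by exact_mod_cast hc)
  convert this using 1
  ext k l
  simp [mul_comm]

theorem one_nonneg {φ : G → ℂ} (hφ : IsPosDef φ) : 0 ≤ φ 1 := by
  have := (hφ 1 ![1]).diag_nonneg (i := 0)
  simpa using this

theorem one_eq_norm {φ : G → ℂ} (hφ : IsPosDef φ) : φ 1 = (‖φ 1‖ : ℂ) :=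
  (RCLike.norm_of_nonneg' hφ.one_nonneg).symm

/-- The 2 × 2 matrix of the points 1, u has nonnegative determinant |φ(1)|² - |φ(u)|². This bound
supplies every summable majorant below. -/
theorem norm_le {φ : G → ℂ} (hφ : IsPosDef φ) (u : G) : ‖φ u‖ ≤ ‖φ 1‖ := by
  have hd := (hφ 2 ![1, u]).det_nonneg
  have hh := (hφ 2 ![1, u]).isHermitian.apply 1 0
  simp only [Matrix.det_fin_two, Matrix.of_apply, Matrix.cons_val_zero, Matrix.cons_val_one,
    inv_one, one_mul, inv_mul_cancel, mul_one] at hd hh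
  rw [← hh, hφ.one_eq_norm, RCLike.star_def, Complex.mul_conj'] at hd
  have h2 : ‖φ u‖ ^ 2 ≤ ‖φ 1‖ ^ 2 := by
    have : (0 : ℂ) ≤ ((‖φ 1‖ * ‖φ 1‖ - ‖φ u‖ ^ 2 : ℝ) : ℂ) := by push_cast; exact hd
    have := Complex.zero_le_real.1 this
    nlinarith
  exact le_of_sq_le_sq h2 (norm_nonneg _)

theorem tsum {φ : ℕ → G → ℂ} (hφ : ∀ n, IsPosDef (φ n)) (hs : Summable fun n => φ n 1) :
    IsPosDef (fun u => ∑' n, φ n u) := by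
  refine of_tendsto (l := Filter.atTop) (φ := fun N u => ∑ n ∈ Finset.range N, φ n u)
    (fun N => sum _ fun n _ => hφ n) fun u => ?_
  exact (Summable.of_norm_bounded hs.norm fun n => (hφ n).norm_le u).hasSum.tendsto_sum_nat

end IsPosDef

theorem posDefFun_tsum {G : Type*} [Group G] [TopologicalSpace G] {φ : ℕ → G → ℂ}
    (hφ : ∀ n, φ n ∈ PosDefFun G) (hs : Summable fun n => φ n 1) :
    (fun u => ∑' n, φ n u) ∈ PosDefFun G :=
  ⟨continuous_tsum (fun n => (hφ n).1) hs.norm fun n u => IsPosDef.norm_le (hφ n).2 u,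
    IsPosDef.tsum (fun n => (hφ n).2) hs⟩

/-- Powers of a real Gram matrix are positive semidefinite over `ℂ`. -/
theorem posSemidef_inner_pow {ι : Type*} [Fintype ι] {m : ℕ}
    (ξ : Fin m → EuclideanSpace ℝ ι) (n : ℕ) :
    (Matrix.of fun k l : Fin m => ((inner ℝ (ξ k) (ξ l) : ℝ) : ℂ) ^ n).PosSemidef := by
  have h1 : (Matrix.of fun k l : Fin m => ((inner ℝ (ξ k) (ξ l) : ℝ) : ℂ)).PosSemidef := by
    have e : (Matrix.of fun k l : Fin m => ((inner ℝ (ξ k) (ξ l) : ℝ) : ℂ)) =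
        (Matrix.of fun a k => ((ξ k a : ℝ) : ℂ)).conjTranspose *
          (Matrix.of fun a k => ((ξ k a : ℝ) : ℂ)) := by
      ext k l
      simp [Matrix.mul_apply, PiLp.inner_apply, mul_comm]
    rw [e]
    exact Matrix.posSemidef_conjTranspose_mul_self _
  induction n with
  | zero =>
    have e : (Matrix.of fun k l : Fin m => ((inner ℝ (ξ k) (ξ l) : ℝ) : ℂ) ^ 0) =
        Matrix.vecMulVec (fun _ => 1) (star fun _ => 1) := by
      ext k l
      simp [Matrix.vecMulVec]
    rw [e]
    exact Matrix.posSemidef_vecMulVec_self_star _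
  | succ n ih =>
    have e : (Matrix.of fun k l : Fin m => ((inner ℝ (ξ k) (ξ l) : ℝ) : ℂ) ^ (n + 1)) =
        (Matrix.of fun k l : Fin m => ((inner ℝ (ξ k) (ξ l) : ℝ) : ℂ) ^ n).hadamard
          (Matrix.of fun k l : Fin m => ((inner ℝ (ξ k) (ξ l) : ℝ) : ℂ)) := by
      ext k l
      simp [pow_succ]
    rw [e]
    exact ih.hadamard h1

/-- A power expansion with positive definite coefficients is positive definite on all spheres. -/
theorem IsPowerExpansion.mem_sphereInfPosDef {G : Type*} [Group G] [TopologicalSpace G]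
    {f : ℝ × G → ℂ} (hf : ContinuousOn f (Set.Icc (-1) 1 ×ˢ Set.univ)) {φ : ℕ → G → ℂ}
    (hφ : IsPowerExpansion f φ) : f ∈ SphereInfPosDef G := by
  obtain ⟨hp, hs, hsum⟩ := hφ
  simp only [SphereInfPosDef, Set.mem_iInter]
  refine fun d _ => ⟨hf, fun m ξ u => ?_⟩
  refine posSemidef_of_tendsto (l := Filter.atTop) (M := fun N : ℕ => ∑ n ∈ Finset.range N,
    (Matrix.of fun k l : Fin m => φ n ((u k)⁻¹ * u l)).hadamard
      (Matrix.of fun k l : Fin m => ((inner ℝ (ξ k).1 (ξ l).1 : ℝ) : ℂ) ^ n))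
    (fun N => Matrix.posSemidef_sum _ fun n _ => ((hp n).2 m u).hadamard
      (posSemidef_inner_pow (fun k => (ξ k).1) n)) fun k l => ?_
  simp only [Matrix.sum_apply, Matrix.hadamard_apply, Matrix.of_apply]
  have hn : |(inner ℝ (ξ k).1 (ξ l).1 : ℝ)| ≤ 1 := by
    have := abs_real_inner_le_norm (ξ k).1 (ξ l).1
    simpa [norm_eq_of_mem_sphere] using this
  have hc := Real.cos_arccos (abs_le.1 hn).1 (abs_le.1 hn).2
  have := hsum (Real.arccos (inner ℝ (ξ k).1 (ξ l).1))
    ⟨Real.arccos_nonneg _, Real.arccos_le_pi _⟩ ((u k)⁻¹ * u l)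
  rw [hc] at this
  exact this.tendsto_sum_nat

/-! ### Walsh analysis on the cube and Bernstein polynomials -/

section

/-- The mean of a vector of signs. -/
def signMean {N : ℕ} (ε : Fin N → ℤˣ) : ℝ := (∑ i, ((ε i : ℤ) : ℝ)) / N

/-- The Walsh function of a set of coordinates. -/
def walsh {N : ℕ} (S : Finset (Fin N)) (ε : Fin N → ℤˣ) : ℝ := ∏ i ∈ S, ((ε i : ℤ) : ℝ)

theorem walsh_mul {N : ℕ} (S : Finset (Fin N)) (ε δ : Fin N → ℤˣ) :
    walsh S (ε * δ) = walsh S ε * walsh S δ := by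
  simp [walsh, Finset.prod_mul_distrib]

theorem intUnit_cast_sq (a : ℤˣ) : ((a : ℤ) : ℝ) * ((a : ℤ) : ℝ) = 1 := by
  rcases Int.units_eq_one_or a with h | h <;> simp [h]

/-- The vertices of the cube, as points of the unit sphere. -/
def cubePoint {d : ℕ} (ε : Fin (d + 1) → ℤˣ) : Sphere d :=
  ⟨WithLp.toLp 2 fun i => ((ε i : ℤ) : ℝ) / √((d + 1 : ℕ) : ℝ), by
    rw [mem_sphere_zero_iff_norm, EuclideanSpace.norm_eq, Real.sqrt_eq_one]
    have h : (((d + 1 : ℕ) : ℝ)) ≠ 0 := by positivity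
    have : ∀ i, ‖((ε i : ℤ) : ℝ) / √((d + 1 : ℕ) : ℝ)‖ ^ 2 = 1 / ((d + 1 : ℕ) : ℝ) := by
      intro i
      rw [Real.norm_eq_abs, sq_abs, div_pow, Real.sq_sqrt (by positivity), sq, intUnit_cast_sq]
    simp only [this, Finset.sum_const, Finset.card_univ, Fintype.card_fin, nsmul_eq_mul]
    field_simp⟩

theorem inner_cubePoint {d : ℕ} (ε δ : Fin (d + 1) → ℤˣ) :
    inner ℝ (cubePoint ε).1 (cubePoint δ).1 = signMean (ε * δ) := by
  have hs : √((d + 1 : ℕ) : ℝ) * √((d + 1 : ℕ) : ℝ) = ((d + 1 : ℕ) : ℝ) :=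
    Real.mul_self_sqrt (by positivity)
  simp only [cubePoint, PiLp.inner_apply, signMean, Finset.sum_div]
  refine Finset.sum_congr rfl fun i _ => ?_
  simp only [RCLike.inner_apply, conj_trivial, Pi.mul_apply, Units.val_mul, Int.cast_mul]
  rw [div_mul_div_comm, hs, mul_comm]

variable {G : Type*}

/-- Arbitrary finite index types are needed to use pairs (vertex, group element) as indices. -/
theorem SpherePosDef.posSemidef [Group G] [TopologicalSpace G] {d : ℕ} {f : ℝ × G → ℂ} (hf : f ∈ SpherePosDef d G)
    {ι : Type*} [Fintype ι] (ξ : ι → Sphere d) (u : ι → G) :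
    (Matrix.of fun k l : ι => f (inner ℝ (ξ k).1 (ξ l).1, (u k)⁻¹ * u l)).PosSemidef := by
  have := (hf.2 (Fintype.card ι) (ξ ∘ (Fintype.equivFin ι).symm)
    (u ∘ (Fintype.equivFin ι).symm)).submatrix (Fintype.equivFin ι)
  convert this using 1
  ext k l
  simp

/-- The Walsh coefficients of a positive definite function restricted to the cube are
positive definite. -/
theorem isPosDef_walsh [Group G] [TopologicalSpace G] {d : ℕ} {f : ℝ × G → ℂ} (hf : f ∈ SpherePosDef d G)
    (S : Finset (Fin (d + 1))) :
    IsPosDef fun u => ∑ ε : Fin (d + 1) → ℤˣ, f (signMean ε, u) * (walsh S ε : ℂ) := by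
  intro m u
  classical
  have hA := SpherePosDef.posSemidef hf
    (fun p : (Fin (d + 1) → ℤˣ) × Fin m => cubePoint p.1) (fun p => u p.2)
  -- Compressing by the Walsh function gives ∑ over ε, δ of f(mean(εδ), ·) w(ε) w(δ). As w is a
  -- character, substituting ε ↦ εδ makes the inner sum independent of δ, so the total is |cube|
  -- times the Walsh coefficient.
  have hB := hA.conjTranspose_mul_mul_same (Matrix.of fun (p : (Fin (d + 1) → ℤˣ) × Fin m)
    (l : Fin m) => if p.2 = l then (walsh S p.1 : ℂ) else 0)
  have hC := hB.smul (a := (((Fintype.card (Fin (d + 1) → ℤˣ) : ℝ)⁻¹ : ℝ) : ℂ))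
    (Complex.zero_le_real.2 (by positivity))
  convert hC using 1
  ext k l
  have h1 : ∀ δ : Fin (d + 1) → ℤˣ,
      ∑ ε : Fin (d + 1) → ℤˣ, f (signMean (ε * δ), (u k)⁻¹ * u l) * (walsh S (ε * δ) : ℂ) =
      ∑ ε : Fin (d + 1) → ℤˣ, f (signMean ε, (u k)⁻¹ * u l) * (walsh S ε : ℂ) := fun δ =>
    Fintype.sum_equiv (Equiv.mulRight δ) _ _ fun ε => rfl
  have h2 : (Fintype.card (Fin (d + 1) → ℤˣ) : ℂ) ≠ 0 := by
    exact_mod_cast Fintype.card_ne_zero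
  simp only [Matrix.smul_apply, Matrix.mul_apply, Matrix.conjTranspose_apply, Matrix.of_apply,
    inner_cubePoint, Fintype.sum_prod_type, smul_eq_mul, apply_ite star, star_zero, ite_mul,
    zero_mul, mul_ite, mul_zero, Finset.sum_ite_eq', Finset.mem_univ, if_true]
  have h3 : ∀ δ : Fin (d + 1) → ℤˣ,
      (∑ ε, star (walsh S ε : ℂ) * f (signMean (ε * δ), (u k)⁻¹ * u l)) * (walsh S δ : ℂ) =
      ∑ ε, f (signMean (ε * δ), (u k)⁻¹ * u l) * (walsh S (ε * δ) : ℂ) := by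
    intro δ
    rw [Finset.sum_mul]
    refine Finset.sum_congr rfl fun ε _ => ?_
    rw [walsh_mul, RCLike.star_def, Complex.conj_ofReal, Complex.ofReal_mul]
    ring
  simp only [h3, h1, Finset.sum_const, Finset.card_univ, nsmul_eq_mul]
  push_cast
  field_simp

/-- The coefficient of `x ^ k` in the `N`-th Bernstein polynomial of `f (·, u)` on `[-1, 1]`. -/
def bernsteinCoeff (f : ℝ × G → ℂ) (N k : ℕ) (u : G) : ℂ :=
  ∑ S ∈ Finset.powersetCard k (Finset.univ : Finset (Fin N)),
    (∑ ε : Fin N → ℤˣ, f (signMean ε, u) * (walsh S ε : ℂ)) * (((2 : ℝ) ^ N)⁻¹ : ℝ)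

theorem isPosDef_bernsteinCoeff [Group G] [TopologicalSpace G] {d : ℕ} {f : ℝ × G → ℂ}
    (hf : f ∈ SpherePosDef d G) (k : ℕ) :
    IsPosDef (bernsteinCoeff f (d + 1) k) :=
  IsPosDef.sum _ fun S _ => (isPosDef_walsh hf S).mul_ofReal (by positivity)

theorem bernsteinCoeff_eq_zero (f : ℝ × G → ℂ) {N k : ℕ} (h : N < k) (u : G) :
    bernsteinCoeff f N k u = 0 := by
  rw [bernsteinCoeff, Finset.powersetCard_eq_empty.2 (by simpa using h), Finset.sum_empty]

/-- Expand the product over subsets S: it equals 2^(-N) ∑ walsh S ε · x^|S|. For |x| ≤ 1 it is the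
probability of ε under independent signs of mean x. -/
theorem sum_bernsteinCoeff (f : ℝ × G → ℂ) (N : ℕ) (u : G) (x : ℝ) :
    ∑ k ∈ Finset.range (N + 1), bernsteinCoeff f N k u * (x : ℂ) ^ k =
      ∑ ε : Fin N → ℤˣ, f (signMean ε, u) * ((∏ i, (1 + ((ε i : ℤ) : ℝ) * x) / 2 : ℝ) : ℂ) := by
  have h1 : ∀ ε : Fin N → ℤˣ, ∏ i, (1 + ((ε i : ℤ) : ℝ) * x) / 2 =
      ∑ k ∈ Finset.range (N + 1), ∑ S ∈ Finset.powersetCard k (Finset.univ : Finset (Fin N)),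
        walsh S ε * (2 ^ N)⁻¹ * x ^ k := by
    intro ε
    rw [Finset.prod_div_distrib, Finset.prod_one_add, Finset.sum_powerset, Finset.sum_div]
    simp only [Finset.card_univ, Fintype.card_fin, Finset.prod_const]
    refine Finset.sum_congr rfl fun k _ => ?_
    rw [Finset.sum_div]
    refine Finset.sum_congr rfl fun S hS => ?_
    rw [Finset.prod_mul_distrib, Finset.prod_const, (Finset.mem_powersetCard.1 hS).2, walsh]
    ring
  simp only [h1, bernsteinCoeff, Finset.sum_mul]
  push_cast
  simp only [Finset.mul_sum]
  rw [Finset.sum_comm (s := Finset.univ)]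
  refine Finset.sum_congr rfl fun k _ => ?_
  rw [Finset.sum_comm (s := Finset.univ)]
  refine Finset.sum_congr rfl fun S _ => Finset.sum_congr rfl fun ε _ => ?_
  ring

/-- The sign vector that is `1` exactly on `T`. -/
def signEquiv (N : ℕ) : Finset (Fin N) ≃ (Fin N → ℤˣ) where
  toFun T i := if i ∈ T then 1 else -1
  invFun ε := Finset.univ.filter fun i => ε i = 1
  left_inv T := by
    ext i
    by_cases h : i ∈ T <;> simp [h]
  right_inv ε := by
    ext i
    rcases Int.units_eq_one_or (ε i) with h | h <;> simp [h]

theorem signMean_signEquiv {N : ℕ} (hN : N ≠ 0) (T : Finset (Fin N)) :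
    signMean (signEquiv N T) = 2 * ((T.card : ℝ) / N) - 1 := by
  have h : ∀ i, (((signEquiv N T i : ℤˣ) : ℤ) : ℝ) = 2 * (if i ∈ T then 1 else 0) - 1 := by
    intro i
    by_cases h : i ∈ T <;> simp [signEquiv, h]; norm_num
  have hN' : (N : ℝ) ≠ 0 := by exact_mod_cast hN
  simp only [signMean, h, Finset.sum_sub_distrib, ← Finset.mul_sum, Finset.sum_boole]
  simp
  field_simp

theorem prod_signEquiv {N : ℕ} (T : Finset (Fin N)) (x : ℝ) :
    ∏ i, (1 + ((signEquiv N T i : ℤ) : ℝ) * x) / 2 =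
      ((1 + x) / 2) ^ T.card * (1 - (1 + x) / 2) ^ (N - T.card) := by
  have h : ∀ i, (1 + ((signEquiv N T i : ℤ) : ℝ) * x) / 2 =
      if i ∈ T then (1 + x) / 2 else 1 - (1 + x) / 2 := by
    intro i
    by_cases h : i ∈ T <;> simp [signEquiv, h]; ring
  simp only [h]
  rw [Finset.prod_ite, Finset.prod_const, Finset.prod_const]
  congr 2
  · simp
  · rw [Finset.filter_not, Finset.card_sdiff]
    simp

/-- Grouping sign vectors by their number of +1's turns the sum into the classical Bernstein sum of
s ↦ f(2s - 1, u) at (1 + x) / 2. -/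
theorem tendsto_sum_bernsteinCoeff [TopologicalSpace G] {f : ℝ × G → ℂ}
    (hf : ContinuousOn f (Set.Icc (-1) 1 ×ˢ Set.univ)) (u : G) {x : ℝ}
    (hx : x ∈ Set.Icc (-1 : ℝ) 1) :
    Filter.Tendsto (fun N => ∑ k ∈ Finset.range (N + 1), bernsteinCoeff f N k u * (x : ℂ) ^ k)
      Filter.atTop (nhds (f (x, u))) := by
  let g : C(unitInterval, ℂ) := ⟨fun t => f (2 * t.1 - 1, u), by
    refine hf.comp_continuous (by fun_prop) fun t => ?_
    have := t.2
    simp only [Set.mem_Icc] at this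
    simp only [Set.mem_prod, Set.mem_Icc, Set.mem_univ, and_true]
    constructor <;> linarith⟩
  let t : unitInterval := ⟨(1 + x) / 2, by constructor <;> linarith [hx.1, hx.2]⟩
  have h1 := ((continuous_eval_const t).tendsto g).comp
    (bernsteinApproximation_uniform g)
  have h2 : g t = f (x, u) := by
    change f (2 * ((1 + x) / 2) - 1, u) = _
    congr 2; ring
  rw [h2] at h1
  refine h1.congr' ?_
  filter_upwards [Filter.eventually_ne_atTop 0] with N hN
  rw [sum_bernsteinCoeff, ← (signEquiv N).sum_comp]
  simp only [prod_signEquiv, signMean_signEquiv hN, Function.comp_apply,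
    bernsteinApproximation.apply]
  rw [← Finset.powerset_univ, Finset.sum_powerset_apply_card (fun j => f (2 * ((j : ℝ) / N) - 1, u) *
    ((((1 + x) / 2) ^ j * (1 - (1 + x) / 2) ^ (N - j) : ℝ) : ℂ)), Finset.card_univ,
    Fintype.card_fin, Finset.sum_range]
  refine Finset.sum_congr rfl fun k _ => ?_
  rw [bernstein_apply]
  change _ • f (2 * ((k : ℝ) / N) - 1, u) = _
  simp only [t, Complex.real_smul, nsmul_eq_mul]
  push_cast
  ring

end

/-! ### Passage to the limit: existence of the power expansion -/

section

variable {G : Type*} [Group G] [TopologicalSpace G]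

/-- For `f ∈ 𝒫(𝕊^∞, G)` the coefficients of the Bernstein polynomials have a limit point that
represents `f` as a power series on the open interval. -/
theorem exists_isPosDef_hasSum {f : ℝ × G → ℂ} (hf : f ∈ SphereInfPosDef G) :
    ∃ φ : ℕ → G → ℂ, (∀ n, IsPosDef (φ n)) ∧ (Summable fun n => φ n 1) ∧
      ∀ x ∈ Set.Ioo (-1 : ℝ) 1, ∀ u, HasSum (fun n => φ n u * (x : ℂ) ^ n) (f (x, u)) := by
  simp only [SphereInfPosDef, Set.mem_iInter] at hf
  have hcont := (hf 1 le_rfl).1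
  -- The cube in N + 2 coordinates lies on the sphere of dimension d = N + 1 ≥ 1.
  set c : ℕ → ℕ → G → ℂ := fun N k u => bernsteinCoeff f (N + 2) k u with hc
  have hpd : ∀ N k, IsPosDef (c N k) := fun N k => isPosDef_bernsteinCoeff (hf (N + 1) (by omega)) k
  have hlim : ∀ u, ∀ x ∈ Set.Icc (-1 : ℝ) 1, Filter.Tendsto
      (fun N => ∑ k ∈ Finset.range (N + 3), c N k u * (x : ℂ) ^ k) Filter.atTop
      (nhds (f (x, u))) := fun u x hx =>
    (tendsto_sum_bernsteinCoeff hcont u hx).comp (Filter.tendsto_add_atTop_nat 2)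
  -- At x = 1, u = 1 all coefficients are nonnegative, so convergence of their sum bounds their ℓ¹
  -- norms uniformly in N.
  have h1 := hlim 1 1 (by simp)
  simp only [Complex.ofReal_one, one_pow, mul_one] at h1
  obtain ⟨M, hM⟩ : ∃ M : ℝ, ∀ N, ‖∑ k ∈ Finset.range (N + 3), c N k 1‖ ≤ M := by
    obtain ⟨M, hM⟩ := (Metric.isBounded_range_of_tendsto _ h1).exists_norm_le
    exact ⟨M, fun N => hM _ ⟨N, rfl⟩⟩
  have hsumN : ∀ N K, ∑ k ∈ Finset.range K, ‖c N k 1‖ ≤ M := by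
    intro N K
    have e : ((∑ k ∈ Finset.range (N + 3), ‖c N k 1‖ : ℝ) : ℂ) =
        ∑ k ∈ Finset.range (N + 3), c N k 1 := by
      push_cast
      exact Finset.sum_congr rfl fun k _ => (hpd N k).one_eq_norm.symm
    have h2 := hM N
    rw [← e, Complex.norm_real, Real.norm_of_nonneg (by positivity)] at h2
    refine le_trans ?_ h2
    rcases le_total K (N + 3) with h | h
    · exact Finset.sum_le_sum_of_subset_of_nonneg (Finset.range_mono h) fun _ _ _ => norm_nonneg _
    · rw [← Finset.sum_subset (Finset.range_mono h)]
      intro k _ hk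
      simp only [Finset.mem_range, not_lt] at hk
      simp only [hc]
      rw [bernsteinCoeff_eq_zero f (by omega), norm_zero]
  have hM0 : 0 ≤ M := by simpa using hsumN 0 0
  have hb : ∀ N k u, ‖c N k u‖ ≤ M := fun N k u => ((hpd N k).norm_le u).trans
    ((Finset.single_le_sum (f := fun k => ‖c N k 1‖) (fun _ _ => norm_nonneg _)
      (Finset.self_mem_range_succ k)).trans (hsumN N (k + 1)))
  -- A nonprincipal ultrafilter gives limits for all k and u at once, where a diagonal subsequence
  -- would need countably many u.
  set l : Filter ℕ := ↑(Filter.hyperfilter ℕ) with hl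
  have hle : l ≤ Filter.atTop := by
    rw [← Nat.cofinite_eq_atTop]; exact Filter.hyperfilter_le_cofinite
  have hex : ∀ k u, ∃ z : ℂ, Filter.Tendsto (fun N => c N k u) l (nhds z) := by
    intro k u
    obtain ⟨z, -, hz⟩ := (isCompact_closedBall (0 : ℂ) M).ultrafilter_le_nhds'
      ((Filter.hyperfilter ℕ).map fun N => c N k u)
      (Ultrafilter.mem_map.2 (Filter.univ_mem' fun N => by simpa using hb N k u))
    exact ⟨z, hz⟩
  choose φ hφ using hex
  have hφpd : ∀ k, IsPosDef (φ k) := fun k => IsPosDef.of_tendsto (l := l) (fun N => hpd N k) (hφ k)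
  have hφs : Summable fun k => ‖φ k 1‖ :=
    summable_of_sum_range_le (fun _ => norm_nonneg _) fun K =>
      le_of_tendsto' (tendsto_finsetSum _ fun k _ => (hφ k 1).norm) fun N => hsumN N K
  refine ⟨φ, hφpd, hφs.of_norm, fun x hx u => ?_⟩
  have hx1 : |x| < 1 := abs_lt.2 hx
  -- The geometric majorant requires |x| < 1; the endpoints are recovered later by continuity.
  have hg : Summable fun k : ℕ => M * |x| ^ k :=
    (summable_geometric_of_lt_one (abs_nonneg x) hx1).mul_left M
  have hbd : ∀ N k, ‖c N k u * (x : ℂ) ^ k‖ ≤ M * |x| ^ k := by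
    intro N k
    rw [norm_mul, norm_pow, Complex.norm_real, Real.norm_eq_abs]
    exact mul_le_mul_of_nonneg_right (hb N k u) (by positivity)
  have ht := tendsto_tsum_of_dominated_convergence (𝓕 := l) hg
    (fun k => (hφ k u).mul_const ((x : ℂ) ^ k)) (Filter.Eventually.of_forall hbd)
  have hfin : ∀ N, ∑' k, c N k u * (x : ℂ) ^ k =
      ∑ k ∈ Finset.range (N + 3), c N k u * (x : ℂ) ^ k := fun N =>
    tsum_eq_sum fun k hk => by
      simp only [Finset.mem_range, not_lt] at hk
      simp only [hc]
      rw [bernsteinCoeff_eq_zero f (by omega), zero_mul]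
  simp only [hfin] at ht
  have := tendsto_nhds_unique ht ((hlim u x ⟨hx.1.le, hx.2.le⟩).mono_left hle)
  rw [← this]
  refine (Summable.of_norm_bounded hφs fun k => ?_).hasSum
  rw [norm_mul, norm_pow, Complex.norm_real, Real.norm_eq_abs]
  exact (mul_le_of_le_one_right (norm_nonneg _) (pow_le_one₀ (abs_nonneg x) hx1.le)).trans
    ((hφpd k).norm_le u)

/-- The coefficients of a uniformly bounded power series with continuous sum are continuous. -/
theorem continuous_coeff {X : Type*} [TopologicalSpace X] {f : ℝ × X → ℂ}
    (hf : ∀ x ∈ Set.Ioo (0 : ℝ) 1, Continuous fun u => f (x, u)) {φ : ℕ → X → ℂ} {b : ℕ → ℝ}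
    (hb : Summable b) (hφ : ∀ n u, ‖φ n u‖ ≤ b n)
    (h : ∀ x ∈ Set.Ioo (0 : ℝ) 1, ∀ u, HasSum (fun n => φ n u * (x : ℂ) ^ n) (f (x, u))) (n : ℕ) :
    Continuous (φ n) := by
  induction n using Nat.strong_induction_on with
  | _ n ih =>
    set S := ∑' k, b (k + (n + 1)) with hS
    have hbn : Summable fun k => b (k + (n + 1)) := (summable_nat_add_iff (n + 1)).2 hb
    set g : ℝ → X → ℂ := fun x u =>
      (f (x, u) - ∑ k ∈ Finset.range n, φ k u * (x : ℂ) ^ k) / (x : ℂ) ^ n with hgdef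
    -- Removing the terms below n and dividing by x^n leaves φ_n plus a remainder O(x), uniformly in
    -- u; hence φ_n is a uniform limit of continuous functions as x → 0+.
    have key : ∀ x ∈ Set.Ioo (0 : ℝ) 1, ∀ u, ‖φ n u - g x u‖ ≤ x * S := by
      intro x hx u
      have hx0 : (x : ℂ) ≠ 0 := by exact_mod_cast hx.1.ne'
      have hs := (hasSum_nat_add_iff' (n + 1)).2 (h x hx u)
      have hs2 := hs.div_const ((x : ℂ) ^ n)
      have e1 : (f (x, u) - ∑ i ∈ Finset.range (n + 1), φ i u * (x : ℂ) ^ i) / (x : ℂ) ^ n =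
          g x u - φ n u := by
        rw [Finset.sum_range_succ, hgdef]
        field_simp
        ring
      rw [e1] at hs2
      rw [norm_sub_rev, ← hs2.tsum_eq]
      refine tsum_of_norm_bounded (hbn.hasSum.mul_left x) fun k => ?_
      have e2 : φ (k + (n + 1)) u * (x : ℂ) ^ (k + (n + 1)) / (x : ℂ) ^ n =
          φ (k + (n + 1)) u * ((x ^ k * x : ℝ) : ℂ) := by
        push_cast
        field_simp
        ring
      rw [e2, norm_mul, Complex.norm_real, Real.norm_of_nonneg (by have := hx.1; positivity)]
      have h3 : x ^ k ≤ 1 := pow_le_one₀ hx.1.le hx.2.le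
      calc ‖φ (k + (n + 1)) u‖ * (x ^ k * x) ≤ b (k + (n + 1)) * (1 * x) := by
            have := hx.1
            have h4 := (norm_nonneg _).trans (hφ (k + (n + 1)) u)
            gcongr
            exact hφ _ _
        _ = x * b (k + (n + 1)) := by ring
    have hunif : TendstoUniformly g (φ n) (nhdsWithin 0 (Set.Ioi 0)) := by
      rw [Metric.tendstoUniformly_iff]
      intro ε hε
      have ht : Filter.Tendsto (fun x : ℝ => x * S) (nhdsWithin 0 (Set.Ioi 0)) (nhds 0) := by
        have : Filter.Tendsto (fun x : ℝ => x * S) (nhds 0) (nhds (0 * S)) :=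
          (continuous_id.mul continuous_const).tendsto 0
        rw [zero_mul] at this
        exact this.mono_left nhdsWithin_le_nhds
      filter_upwards [ht.eventually_lt_const hε, Ioo_mem_nhdsGT (zero_lt_one (α := ℝ))]
        with x hx hx2 u
      rw [dist_eq_norm]
      exact (key x hx2 u).trans_lt hx
    refine hunif.continuous (Filter.Eventually.frequently ?_)
    filter_upwards [Ioo_mem_nhdsGT (zero_lt_one (α := ℝ))] with x hx
    exact ((hf x hx).sub (continuous_finsetSum _ fun k hk =>
      (ih k (Finset.mem_range.1 hk)).mul continuous_const)).div_const _

/-- Schoenberg's theorem on `𝕊^∞ × G`: existence of the power expansion. -/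
theorem exists_isPowerExpansion {f : ℝ × G → ℂ} (hf : f ∈ SphereInfPosDef G) :
    ∃ φ : ℕ → G → ℂ, IsPowerExpansion f φ := by
  obtain ⟨φ, hpd, hs, hsum⟩ := exists_isPosDef_hasSum hf
  simp only [SphereInfPosDef, Set.mem_iInter] at hf
  have hcont := (hf 1 le_rfl).1
  have hcx : ∀ u, ContinuousOn (fun x : ℝ => f (x, u)) (Set.Icc (-1) 1) := fun u =>
    hcont.comp (by fun_prop) fun x hx => ⟨hx, Set.mem_univ _⟩
  have hcu : ∀ x ∈ Set.Icc (-1 : ℝ) 1, Continuous fun u => f (x, u) := fun x hx =>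
    hcont.comp_continuous (by fun_prop) fun u => ⟨hx, Set.mem_univ _⟩
  have hbound : ∀ u, ∀ n, ∀ x ∈ Set.Icc (-1 : ℝ) 1, ‖φ n u * (x : ℂ) ^ n‖ ≤ ‖φ n 1‖ := by
    intro u n x hx
    rw [norm_mul, norm_pow, Complex.norm_real, Real.norm_eq_abs]
    exact (mul_le_of_le_one_right (norm_nonneg _)
      (pow_le_one₀ (abs_nonneg x) (abs_le.2 hx))).trans ((hpd n).norm_le u)
  refine ⟨φ, fun n => ⟨continuous_coeff (fun x hx => hcu x ⟨by linarith [hx.1], hx.2.le⟩) hs.norm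
    (fun n u => (hpd n).norm_le u) (fun x hx u => hsum x ⟨by linarith [hx.1], hx.2⟩ u) n, hpd n⟩,
    hs, fun θ _ u => ?_⟩
  have hx : Real.cos θ ∈ Set.Icc (-1 : ℝ) 1 := ⟨Real.neg_one_le_cos θ, Real.cos_le_one θ⟩
  have heq : Set.EqOn (fun x : ℝ => ∑' n, φ n u * (x : ℂ) ^ n) (fun x => f (x, u))
      (Set.Icc (-1) 1) := by
    have h1 : ContinuousOn (fun x : ℝ => ∑' n, φ n u * (x : ℂ) ^ n) (Set.Icc (-1) 1) :=
      continuousOn_tsum (fun n => by fun_prop) hs.norm fun n x hx => hbound u n x hx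
    refine Set.EqOn.of_subset_closure (s := Set.Ioo (-1) 1) (fun x hx => (hsum x hx u).tsum_eq)
      h1 (hcx u) Set.Ioo_subset_Icc_self ?_
    rw [closure_Ioo (by norm_num)]
  have := heq hx
  simp only at this
  rw [← this]
  exact (Summable.of_norm_bounded hs.norm fun n => hbound u n _ hx).hasSum

end

/-! ### Ultraspherical polynomials: differential equation, bound, orthogonality -/

section

open Polynomial

/-- The normalized ultraspherical polynomials, by their three term recurrence. -/
def ultraPoly (d : ℕ) : ℕ → ℝ[X]
  | 0 => 1
  | 1 => X
  | n + 2 => C (((n : ℝ) + d)⁻¹) *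
      ((2 * (n : ℝ[X]) + (d : ℝ[X]) + 1) * X * ultraPoly d (n + 1) - ((n : ℝ[X]) + 1) * ultraPoly d n)

theorem natCast_add_natCast_ne_zero {d : ℕ} (hd : 1 ≤ d) (n : ℕ) : ((n : ℝ[X]) + (d : ℝ[X])) ≠ 0 := by
  have : ((n + d : ℕ) : ℝ[X]) ≠ 0 := Nat.cast_ne_zero.2 (by omega)
  exact_mod_cast this

theorem ultraPoly_rec {d : ℕ} (hd : 1 ≤ d) (n : ℕ) :
    ((n : ℝ[X]) + (d : ℝ[X])) * ultraPoly d (n + 2) =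
      (2 * (n : ℝ[X]) + (d : ℝ[X]) + 1) * X * ultraPoly d (n + 1) - ((n : ℝ[X]) + 1) * ultraPoly d n := by
  have h : (n : ℝ) + d ≠ 0 := by
    have : (1 : ℝ) ≤ d := by exact_mod_cast hd
    positivity
  have e : ((n : ℝ[X]) + (d : ℝ[X])) * C (((n : ℝ) + d)⁻¹) = 1 := by
    rw [show ((n : ℝ[X]) + (d : ℝ[X])) = C ((n : ℝ) + d) by simp, ← C_mul, mul_inv_cancel₀ h, C_1]
  rw [ultraPoly, ← mul_assoc, e, one_mul]

theorem ultraPoly_rec_eval {d : ℕ} (hd : 1 ≤ d) (n : ℕ) (x : ℝ) :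
    ((n : ℝ) + d) * (ultraPoly d (n + 2)).eval x =
      (2 * (n : ℝ) + d + 1) * x * (ultraPoly d (n + 1)).eval x -
        ((n : ℝ) + 1) * (ultraPoly d n).eval x := by
  simpa using congrArg (eval x) (ultraPoly_rec hd n)

theorem ultraPoly_eval_one {d : ℕ} (hd : 1 ≤ d) (n : ℕ) : (ultraPoly d n).eval 1 = 1 := by
  induction n using Nat.twoStepInduction with
  | zero => simp [ultraPoly]
  | one => simp [ultraPoly]
  | more n h0 h1 =>
    have h : (n : ℝ) + d ≠ 0 := by
      have : (1 : ℝ) ≤ d := by exact_mod_cast hd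
      positivity
    have := ultraPoly_rec_eval hd n 1
    rw [h0, h1] at this
    apply mul_left_cancel₀ h
    linarith

theorem ultraPoly_eval_neg_one {d : ℕ} (hd : 1 ≤ d) (n : ℕ) :
    (ultraPoly d n).eval (-1) = (-1) ^ n := by
  induction n using Nat.twoStepInduction with
  | zero => simp [ultraPoly]
  | one => simp [ultraPoly]
  | more n h0 h1 =>
    have h : (n : ℝ) + d ≠ 0 := by
      have : (1 : ℝ) ≤ d := by exact_mod_cast hd
      positivity
    have := ultraPoly_rec_eval hd n (-1)
    rw [h0, h1] at this
    apply mul_left_cancel₀ h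
    rw [this]
    ring

/-- The two first order differential relations between consecutive ultraspherical polynomials. -/
theorem ultraPoly_derivative {d : ℕ} (hd : 1 ≤ d) (n : ℕ) :
    (1 - X ^ 2) * derivative (ultraPoly d (n + 1)) =
        ((n : ℝ[X]) + 1) * (ultraPoly d n - X * ultraPoly d (n + 1)) ∧
      (1 - X ^ 2) * derivative (ultraPoly d n) =
        ((n : ℝ[X]) + (d : ℝ[X]) - 1) * (X * ultraPoly d n - ultraPoly d (n + 1)) := by
  induction n with
  | zero => constructor <;> simp [ultraPoly]; ring
  | succ n ih =>
    obtain ⟨hA, hB⟩ := ih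
    have hr := ultraPoly_rec hd n
    have hdr := congrArg derivative hr
    simp only [derivative_mul, derivative_sub, derivative_add, derivative_natCast, derivative_X,
      derivative_one, derivative_ofNat, zero_mul, add_zero, zero_add, mul_zero, mul_one] at hdr
    -- The first relation comes from differentiating the recurrence, the second from the previous
    -- first relation and the recurrence itself.
    refine ⟨mul_left_cancel₀ (natCast_add_natCast_ne_zero hd n) ?_, ?_⟩
    · push_cast
      linear_combination (1 - X ^ 2) * hdr + (2 * (n : ℝ[X]) + (d : ℝ[X]) + 1) * X * hA -
        ((n : ℝ[X]) + 1) * hB + ((n : ℝ[X]) + 2) * X * hr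
    · push_cast
      linear_combination hA + hr

/-- The differential equation of the ultraspherical polynomials. -/
theorem ultraPoly_ode {d : ℕ} (hd : 1 ≤ d) (m : ℕ) :
    (1 - X ^ 2) * derivative (derivative (ultraPoly d m)) - (d : ℝ[X]) * X *
      derivative (ultraPoly d m) + (m : ℝ[X]) * ((m : ℝ[X]) + (d : ℝ[X]) - 1) * ultraPoly d m = 0 := by
  cases m with
  | zero => simp [ultraPoly]
  | succ n =>
    obtain ⟨hA, hB⟩ := ultraPoly_derivative hd n
    have hdA := congrArg derivative hA
    simp only [derivative_mul, derivative_sub, derivative_add, derivative_natCast, derivative_X,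
      derivative_one, derivative_X_pow, zero_mul, add_zero, zero_add, zero_sub, one_mul] at hdA
    have hne : (1 - X ^ 2 : ℝ[X]) ≠ 0 := by
      intro h
      have := congrArg (eval 0) h
      simp at this
    apply mul_left_cancel₀ hne
    have hC2 : (C 2 : ℝ[X]) = 2 := map_ofNat C 2
    simp [hC2] at hdA
    push_cast
    linear_combination (1 - X ^ 2) * hdA + ((n : ℝ[X]) + 1) * hB -
      ((n : ℝ[X]) + 1 + (d : ℝ[X]) - 2) * X * hA

/-- Sonin's argument: by the differential equation, E = N y² + (1 - x²) y'² has derivative 2(d - 1)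
x y'², so on [-1, 1] it is largest at ±1, where it equals N. The case m = 0 is separate because then
N = 0. -/
theorem ultraPoly_abs_le {d : ℕ} (hd : 1 ≤ d) (m : ℕ) {x : ℝ} (hx : x ∈ Set.Icc (-1 : ℝ) 1) :
    |(ultraPoly d m).eval x| ≤ 1 := by
  rcases Nat.eq_zero_or_pos m with rfl | hm
  · simp [ultraPoly]
  set y := ultraPoly d m with hy
  have hd' : (1 : ℝ) ≤ d := by exact_mod_cast hd
  have hm' : (1 : ℝ) ≤ m := by exact_mod_cast hm
  set N : ℝ := m * (m + d - 1) with hN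
  have hN0 : 0 < N := by
    rw [hN]
    have : 0 < (m : ℝ) + d - 1 := by linarith
    positivity
  set E : ℝ[X] := C N * y ^ 2 + (1 - X ^ 2) * derivative y ^ 2 with hE
  have hE' : derivative E = C (2 * ((d : ℝ) - 1)) * X * derivative y ^ 2 := by
    have h := ultraPoly_ode hd m
    rw [← hy] at h
    have hNC : C N = (m : ℝ[X]) * ((m : ℝ[X]) + (d : ℝ[X]) - 1) := by simp [hN]
    rw [hE, hNC]
    simp only [derivative_mul, derivative_sub, derivative_add, derivative_natCast, derivative_X,
      derivative_one, derivative_pow]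
    have hC2 : (C 2 : ℝ[X]) = 2 := map_ofNat C 2
    simp [hC2]
    linear_combination 2 * derivative y * h
  have hder : ∀ t, deriv (fun t => E.eval t) t = 2 * ((d : ℝ) - 1) * t * (derivative y).eval t ^ 2 := by
    intro t
    rw [Polynomial.deriv, hE']
    simp
  have hbd : E.eval x ≤ N := by
    rcases le_total 0 x with h | h
    · have hmono : MonotoneOn (fun t => E.eval t) (Set.Icc 0 1) := by
        refine monotoneOn_of_deriv_nonneg (convex_Icc 0 1) E.continuous.continuousOn
          E.differentiable.differentiableOn fun t ht => ?_
        rw [interior_Icc] at ht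
        rw [hder]
        have : 0 ≤ (d : ℝ) - 1 := by linarith
        have := ht.1
        positivity
      have := hmono ⟨h, hx.2⟩ (Set.right_mem_Icc.2 zero_le_one) hx.2
      simpa [hE, hy, ultraPoly_eval_one hd] using this
    · have hanti : AntitoneOn (fun t => E.eval t) (Set.Icc (-1) 0) := by
        refine antitoneOn_of_deriv_nonpos (convex_Icc (-1) 0) E.continuous.continuousOn
          E.differentiable.differentiableOn fun t ht => ?_
        rw [interior_Icc] at ht
        rw [hder]
        have h1 : 0 ≤ (d : ℝ) - 1 := by linarith
        have h2 : 2 * ((d : ℝ) - 1) * t ≤ 0 :=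
          mul_nonpos_of_nonneg_of_nonpos (by positivity) ht.2.le
        exact mul_nonpos_of_nonpos_of_nonneg h2 (by positivity)
      have := hanti (Set.left_mem_Icc.2 (by norm_num)) ⟨hx.1, h⟩ hx.1
      simp only [hE, hy, eval_add, eval_mul, eval_C, eval_pow, ultraPoly_eval_neg_one hd, eval_sub,
        eval_one, eval_X] at this
      rw [← pow_mul, mul_comm m 2, pow_mul] at this
      norm_num at this
      simpa [hE, hy] using this
  have h1 : 0 ≤ (1 - x ^ 2) * (derivative y).eval x ^ 2 := by
    have : 0 ≤ 1 - x ^ 2 := by nlinarith [hx.1, hx.2]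
    positivity
  simp only [hE, eval_add, eval_mul, eval_C, eval_pow, eval_sub, eval_one, eval_X] at hbd
  have h2 : y.eval x ^ 2 ≤ 1 := by nlinarith
  exact (sq_le_one_iff_abs_le_one _).1 h2

/-- Integrals of total derivatives against the ultraspherical weight vanish. -/
theorem integral_ultraWeight_eq_zero {d : ℕ} (hd : 1 ≤ d) (W : ℝ[X]) :
    ∫ θ in (0 : ℝ)..Real.pi, ((1 - X ^ 2) * derivative W - (d : ℝ[X]) * X * W).eval (Real.cos θ) *
      Real.sin θ ^ (d - 1) = 0 := by
  obtain ⟨k, rfl⟩ := Nat.exists_eq_add_of_le' hd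
  have h : ∀ θ : ℝ, HasDerivAt (fun θ => -(Real.sin θ ^ (k + 1) * W.eval (Real.cos θ)))
      (((1 - X ^ 2) * derivative W - ((k + 1 : ℕ) : ℝ[X]) * X * W).eval (Real.cos θ) *
        Real.sin θ ^ (k + 1 - 1)) θ := by
    intro θ
    have h1 := (Real.hasDerivAt_sin θ).pow (k + 1)
    have h2 := (W.hasDerivAt (Real.cos θ)).comp θ (Real.hasDerivAt_cos θ)
    refine (h1.mul h2).neg.congr_deriv ?_
    have h3 := Real.sin_sq_add_cos_sq θ
    simp only [eval_sub, eval_mul, eval_one, eval_pow, eval_X, eval_natCast, add_tsub_cancel_right,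
      Function.comp, Pi.pow_apply]
    linear_combination (eval (Real.cos θ) (derivative W) * Real.sin θ ^ k) * h3
  rw [intervalIntegral.integral_eq_sub_of_hasDerivAt (fun θ _ => h θ)]
  · simp
  · exact Continuous.intervalIntegrable (by fun_prop) _ _

/-- Sturm–Liouville: the Wronskian p'q - pq' turns the difference of the two differential equations
into a total derivative, leaving (m - n)(m + n + d - 1) times the integral. -/
theorem integral_ultraPoly_mul {d : ℕ} (hd : 1 ≤ d) {m n : ℕ} (hmn : m ≠ n) :
    ∫ θ in (0 : ℝ)..Real.pi, (ultraPoly d n).eval (Real.cos θ) *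
      ((ultraPoly d m).eval (Real.cos θ) * Real.sin θ ^ (d - 1)) = 0 := by
  set p := ultraPoly d n with hp
  set q := ultraPoly d m with hq
  have h := integral_ultraWeight_eq_zero hd (derivative p * q - p * derivative q)
  have h1 := ultraPoly_ode hd n
  have h2 := ultraPoly_ode hd m
  set c : ℝ := m * (m + d - 1) - n * (n + d - 1) with hc
  have hcC : C c = (m : ℝ[X]) * ((m : ℝ[X]) + (d : ℝ[X]) - 1) - (n : ℝ[X]) * ((n : ℝ[X]) + (d : ℝ[X]) - 1) := by
    simp [hc]
  have e : (1 - X ^ 2) * derivative (derivative p * q - p * derivative q) -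
      (d : ℝ[X]) * X * (derivative p * q - p * derivative q) = C c * p * q := by
    rw [hcC]
    simp only [derivative_mul, derivative_sub]
    linear_combination q * h1 - p * h2
  rw [e] at h
  have hc0 : c ≠ 0 := by
    have : c = (m - n) * (m + n + d - 1) := by rw [hc]; ring
    rw [this]
    have hd' : (1 : ℝ) ≤ d := by exact_mod_cast hd
    have h3 : (1 : ℝ) ≤ m + n := by
      have : 1 ≤ m + n := by omega
      exact_mod_cast this
    exact mul_ne_zero (sub_ne_zero.2 (by exact_mod_cast hmn)) (by linarith)
  have e2 : ∀ θ : ℝ, (C c * p * q).eval (Real.cos θ) * Real.sin θ ^ (d - 1) =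
      c * (p.eval (Real.cos θ) * (q.eval (Real.cos θ) * Real.sin θ ^ (d - 1))) := by
    intro θ
    simp only [eval_mul, eval_C]
    ring
  simp only [e2, intervalIntegral.integral_const_mul] at h
  exact (mul_eq_zero.1 h).resolve_left hc0

theorem integral_ultraPoly_mul_self_pos {d : ℕ} (hd : 1 ≤ d) (m : ℕ) :
    0 < ∫ θ in (0 : ℝ)..Real.pi, (ultraPoly d m).eval (Real.cos θ) *
      ((ultraPoly d m).eval (Real.cos θ) * Real.sin θ ^ (d - 1)) := by
  have hcont : Continuous fun θ : ℝ => (ultraPoly d m).eval (Real.cos θ) := by fun_prop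
  refine intervalIntegral.integral_pos Real.pi_pos (by fun_prop) (fun θ hθ => ?_) ?_
  · have := Real.sin_nonneg_of_mem_Icc ⟨hθ.1.le, hθ.2⟩
    rw [← mul_assoc]
    exact mul_nonneg (mul_self_nonneg _) (by positivity)
  · have h1 : Filter.Tendsto (fun θ : ℝ => (ultraPoly d m).eval (Real.cos θ))
        (nhdsWithin 0 (Set.Ioi 0)) (nhds 1) := by
      have := hcont.tendsto 0
      rw [Real.cos_zero, ultraPoly_eval_one hd] at this
      exact this.mono_left nhdsWithin_le_nhds
    obtain ⟨θ, hθ, hθ2⟩ := ((h1.eventually_const_lt zero_lt_one).and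
      (Ioo_mem_nhdsGT Real.pi_pos)).exists
    have := Real.sin_pos_of_mem_Ioo hθ2
    exact ⟨θ, ⟨hθ2.1.le, hθ2.2.le⟩, by positivity⟩

/-- Absolutely summable expansions in ultraspherical polynomials are unique. -/
theorem eq_zero_of_hasSum_ultraPoly {d : ℕ} (hd : 1 ≤ d) {a : ℕ → ℂ}
    (ha : Summable fun n => ‖a n‖)
    (h : ∀ θ ∈ Set.Icc 0 Real.pi,
      HasSum (fun n => a n * (((ultraPoly d n).eval (Real.cos θ) : ℝ) : ℂ)) 0) (m : ℕ) : a m = 0 := by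
  set w : ℝ → ℝ := fun θ => (ultraPoly d m).eval (Real.cos θ) * Real.sin θ ^ (d - 1) with hw
  have hwc : Continuous w := by fun_prop
  have hcos : ∀ θ : ℝ, Real.cos θ ∈ Set.Icc (-1 : ℝ) 1 := fun θ =>
    ⟨Real.neg_one_le_cos θ, Real.cos_le_one θ⟩
  have hw1 : ∀ θ, |w θ| ≤ 1 := by
    intro θ
    rw [hw, abs_mul, abs_pow]
    exact mul_le_one₀ (ultraPoly_abs_le hd m (hcos θ)) (by positivity)
      (pow_le_one₀ (abs_nonneg _) (Real.abs_sin_le_one θ))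
  have key := intervalIntegral.hasSum_integral_of_dominated_convergence (a := 0) (b := Real.pi)
    (μ := MeasureTheory.volume)
    (F := fun n θ => a n * (((ultraPoly d n).eval (Real.cos θ) * w θ : ℝ) : ℂ)) (f := fun _ => 0)
    (fun n _ => ‖a n‖) (fun n => by
      refine Continuous.aestronglyMeasurable ?_
      fun_prop)
    (fun n => Filter.Eventually.of_forall fun θ _ => by
      rw [norm_mul, Complex.norm_real, Real.norm_eq_abs, abs_mul]
      exact mul_le_of_le_one_right (norm_nonneg _)
        (mul_le_one₀ (ultraPoly_abs_le hd n (hcos θ)) (abs_nonneg _) (hw1 θ)))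
    (Filter.Eventually.of_forall fun θ _ => ha) (by simp)
    (Filter.Eventually.of_forall fun θ hθ => by
      rw [Set.uIoc_of_le Real.pi_pos.le] at hθ
      have := (h θ ⟨hθ.1.le, hθ.2⟩).mul_right (w θ : ℂ)
      rw [zero_mul] at this
      have e : (fun n => a n * (((ultraPoly d n).eval (Real.cos θ) * w θ : ℝ) : ℂ)) =
          fun n => a n * (((ultraPoly d n).eval (Real.cos θ) : ℝ) : ℂ) * (w θ : ℂ) := by
        funext n
        push_cast
        ring
      rw [e]
      exact this)
  simp only [intervalIntegral.integral_const_mul, intervalIntegral.integral_ofReal,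
    intervalIntegral.integral_zero] at key
  have h2 := hasSum_single m (f := fun n => a n *
      ((∫ θ in (0 : ℝ)..Real.pi, (ultraPoly d n).eval (Real.cos θ) * w θ : ℝ) : ℂ)) fun n hn => by
    rw [integral_ultraPoly_mul hd hn.symm, Complex.ofReal_zero, mul_zero]
  have h3 := h2.unique key
  refine (mul_eq_zero.1 h3).resolve_right ?_
  exact_mod_cast (integral_ultraPoly_mul_self_pos hd m).ne'

end

/-! ### Gegenbauer polynomials from their generating function -/

section

open Polynomial

theorem iteratedDeriv_id_mul {g : ℝ → ℝ} (n : ℕ) (hg : ContDiffAt ℝ (n + 1 : ℕ) g 0) :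
    iteratedDeriv (n + 1) (fun r => r * g r) 0 = (n + 1) * iteratedDeriv n g 0 := by
  rw [iteratedDeriv_fun_mul (f := fun r => r) contDiffAt_id hg, Finset.sum_eq_single 1]
  · simp [iteratedDeriv_fun_id]
  · intro i _ hi
    rcases i with _ | _ | i
    · simp [iteratedDeriv_fun_id]
    · exact absurd rfl hi
    · simp [iteratedDeriv_fun_id]
  · simp

/-- The generating function of the Gegenbauer polynomials. -/
def gegenbauerGen (lam x : ℝ) (r : ℝ) : ℝ := (1 - 2 * x * r + r ^ 2) ^ (-lam)

theorem eventually_gegenbauer_base_pos (x : ℝ) :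
    ∀ᶠ r in nhds (0 : ℝ), 0 < 1 - 2 * x * r + r ^ 2 := by
  have : ContinuousAt (fun r : ℝ => 1 - 2 * x * r + r ^ 2) 0 := by fun_prop
  exact this.eventually_const_lt (by simp)

theorem contDiffAt_gegenbauerGen (lam x : ℝ) (n : ℕ∞) : ContDiffAt ℝ n (gegenbauerGen lam x) 0 := by
  unfold gegenbauerGen
  exact ContDiffAt.rpow_const_of_ne (by fun_prop) (by simp)

/-- This is (1 - 2xr + r²) F' = 2λ(x - r) F, valid where the base is positive. Powers of r are
nested so that `iteratedDeriv_id_mul` applies to each factor. -/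
theorem gegenbauerGen_ode (lam x : ℝ) :
    (fun r => deriv (gegenbauerGen lam x) r - 2 * x * (r * deriv (gegenbauerGen lam x) r) +
      r * (r * deriv (gegenbauerGen lam x) r)) =ᶠ[nhds 0]
    fun r => 2 * lam * x * gegenbauerGen lam x r - 2 * lam * (r * gegenbauerGen lam x r) := by
  filter_upwards [eventually_gegenbauer_base_pos x] with r hr
  have h1 : HasDerivAt (fun r : ℝ => 1 - 2 * x * r + r ^ 2) (-(2 * x) + 2 * r) r := by
    have := (((hasDerivAt_id r).const_mul (2 * x)).const_sub 1).add ((hasDerivAt_id r).pow 2)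
    refine this.congr_deriv ?_
    simp
  have h2 : HasDerivAt (gegenbauerGen lam x) _ r := h1.rpow_const (p := -lam) (Or.inl hr.ne')
  have h3 : gegenbauerGen lam x r =
      (1 - 2 * x * r + r ^ 2) ^ (-lam - 1) * (1 - 2 * x * r + r ^ 2) := by
    rw [gegenbauerGen, ← Real.rpow_add_one hr.ne']
    ring_nf
  rw [h2.deriv, h3]
  ring

theorem iteratedDeriv_gegenbauerGen (lam x : ℝ) (n : ℕ) :
    iteratedDeriv (n + 2) (gegenbauerGen lam x) 0 =
      2 * x * ((n : ℝ) + 1 + lam) * iteratedDeriv (n + 1) (gegenbauerGen lam x) 0 -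
        ((n : ℝ) + 1) * (n + 2 * lam) * iteratedDeriv n (gegenbauerGen lam x) 0 := by
  set F := gegenbauerGen lam x with hF
  have hFc : ∀ k : ℕ, ContDiffAt ℝ k F 0 := fun k => contDiffAt_gegenbauerGen lam x k
  have hDc : ∀ k : ℕ, ContDiffAt ℝ k (deriv F) 0 := fun k =>
    ((hFc (k + 1)).fderiv_right (m := k) (by push_cast; rfl)).clm_apply contDiffAt_const
  have hrD : ∀ k : ℕ, ContDiffAt ℝ k (fun r => r * deriv F r) 0 := fun k =>
    contDiffAt_id.mul (hDc k)
  have hrrD : ∀ k : ℕ, ContDiffAt ℝ k (fun r => r * (r * deriv F r)) 0 := fun k =>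
    contDiffAt_id.mul (hrD k)
  have hrF : ∀ k : ℕ, ContDiffAt ℝ k (fun r => r * F r) 0 := fun k =>
    contDiffAt_id.mul (hFc k)
  have h := (gegenbauerGen_ode lam x).iteratedDeriv_eq (n + 1)
  rw [← hF] at h
  rw [iteratedDeriv_fun_add ((hDc _).sub (contDiffAt_const.mul (hrD _))) (hrrD _),
    iteratedDeriv_fun_sub (hDc _) (contDiffAt_const.mul (hrD _)),
    iteratedDeriv_fun_sub (contDiffAt_const.mul (hFc _)) (contDiffAt_const.mul (hrF _)),
    iteratedDeriv_const_mul_field, iteratedDeriv_const_mul_field, iteratedDeriv_const_mul_field,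
    iteratedDeriv_id_mul n (hDc _), iteratedDeriv_id_mul n (hrD _), iteratedDeriv_id_mul n (hFc _),
    ← iteratedDeriv_succ', ← iteratedDeriv_succ'] at h
  have h4 : (n : ℝ) * iteratedDeriv n F 0 = iteratedDeriv n (fun r => r * deriv F r) 0 := by
    cases n with
    | zero => simp
    | succ k => rw [iteratedDeriv_id_mul k (hDc _), ← iteratedDeriv_succ']; push_cast; ring
  rw [← h4] at h
  linear_combination h

theorem gegenbauer_zero (lam x : ℝ) : gegenbauer lam 0 x = 1 := by
  simp [gegenbauer]

theorem gegenbauer_one (lam x : ℝ) : gegenbauer lam 1 x = 2 * lam * x := by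
  have h := (gegenbauerGen_ode lam x).eq_of_nhds
  simp only [zero_mul, mul_zero, sub_zero, add_zero] at h
  have h2 : gegenbauerGen lam x 0 = 1 := by simp [gegenbauerGen]
  rw [h2, mul_one] at h
  rw [gegenbauer, iteratedDeriv_one, Nat.factorial_one, Nat.cast_one, div_one]
  exact h

theorem gegenbauer_rec (lam x : ℝ) (n : ℕ) :
    ((n : ℝ) + 2) * gegenbauer lam (n + 2) x =
      2 * x * ((n : ℝ) + 1 + lam) * gegenbauer lam (n + 1) x -
        ((n : ℝ) + 2 * lam) * gegenbauer lam n x := by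
  have h := iteratedDeriv_gegenbauerGen lam x n
  have hn : (n.factorial : ℝ) ≠ 0 := by exact_mod_cast n.factorial_ne_zero
  have h1 : (n : ℝ) + 1 ≠ 0 := by positivity
  have h2 : (n : ℝ) + 2 ≠ 0 := by positivity
  change ((n : ℝ) + 2) * (iteratedDeriv (n + 2) (gegenbauerGen lam x) 0 / ((n + 2).factorial : ℝ)) =
    2 * x * ((n : ℝ) + 1 + lam) *
      (iteratedDeriv (n + 1) (gegenbauerGen lam x) 0 / ((n + 1).factorial : ℝ)) -
        ((n : ℝ) + 2 * lam) * (iteratedDeriv n (gegenbauerGen lam x) 0 / (n.factorial : ℝ))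
  rw [h, Nat.factorial_succ (n + 1), Nat.factorial_succ n]
  push_cast
  rw [show (n : ℝ) + 1 + 1 = n + 2 by ring]
  field_simp

theorem gegenbauer_eval_one {lam : ℝ} (n : ℕ) :
    ((n : ℝ) + 1) * gegenbauer lam (n + 1) 1 = ((n : ℝ) + 2 * lam) * gegenbauer lam n 1 := by
  induction n with
  | zero => simp [gegenbauer_zero, gegenbauer_one]
  | succ n ih =>
    have := gegenbauer_rec lam 1 n
    push_cast
    linear_combination this + ih

theorem gegenbauer_eval_one_pos {lam : ℝ} (hl : 0 < lam) (n : ℕ) : 0 < gegenbauer lam n 1 := by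
  induction n with
  | zero => simp [gegenbauer_zero]
  | succ n ih =>
    have := gegenbauer_eval_one (lam := lam) n
    have h : 0 < ((n : ℝ) + 1) * gegenbauer lam (n + 1) 1 := by rw [this]; positivity
    exact (mul_pos_iff_of_pos_left (by positivity)).1 h

/-- Without division this also holds for d = 1, where both sides vanish for n ≥ 1. -/
theorem gegenbauer_eq {d : ℕ} (hd : 1 ≤ d) (n : ℕ) (x : ℝ) :
    gegenbauer (((d : ℝ) - 1) / 2) n x =
      gegenbauer (((d : ℝ) - 1) / 2) n 1 * (ultraPoly d n).eval x := by
  induction n using Nat.twoStepInduction with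
  | zero => simp [ultraPoly, gegenbauer_zero]
  | one => simp [ultraPoly, gegenbauer_one]
  | more n h0 h1 =>
    have h2 : (n : ℝ) + 2 ≠ 0 := by positivity
    have hr := gegenbauer_rec (((d : ℝ) - 1) / 2) x n
    have hp := ultraPoly_rec_eval hd n x
    have e1 := gegenbauer_eval_one (lam := ((d : ℝ) - 1) / 2) n
    have e2 := gegenbauer_eval_one (lam := ((d : ℝ) - 1) / 2) (n + 1)
    push_cast at e2
    rw [h0, h1] at hr
    apply mul_left_cancel₀ h2
    linear_combination hr - (ultraPoly d (n + 2)).eval x * e2 -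
      gegenbauer (((d : ℝ) - 1) / 2) (n + 1) 1 * hp + (ultraPoly d n).eval x * e1

theorem ultraPoly_one_eq_T (n : ℕ) : ultraPoly 1 n = Chebyshev.T ℝ (n : ℤ) := by
  induction n using Nat.twoStepInduction with
  | zero => simp [ultraPoly]
  | one => simp [ultraPoly]
  | more n h0 h1 =>
    have hr := ultraPoly_rec le_rfl n
    have hT := Chebyshev.T_add_two ℝ (n : ℤ)
    push_cast at h1 hT hr ⊢
    apply mul_left_cancel₀ (natCast_add_natCast_ne_zero le_rfl n)
    push_cast
    rw [hr, h0, h1, hT]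
    ring

theorem ultraspherical_eq {d : ℕ} (hd : 1 ≤ d) (n : ℕ) (x : ℝ) :
    ultraspherical d n x = (ultraPoly d n).eval x := by
  unfold ultraspherical
  split_ifs with h
  · rw [h, ultraPoly_one_eq_T]
  · have : (2 : ℝ) ≤ d := by exact_mod_cast (show 2 ≤ d by omega)
    have hp := gegenbauer_eval_one_pos (lam := ((d : ℝ) - 1) / 2) (by linarith) n
    rw [gegenbauer_eq hd, mul_div_cancel_left₀ _ hp.ne']

end

/-! ### Powers in the ultraspherical basis and the Schoenberg functions -/

section

/-- The coefficient of `c_n(d, x)` in the ultraspherical expansion of `x ^ m`. -/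
def connCoeff (d : ℕ) : ℕ → ℕ → ℝ
  | 0, n => if n = 0 then 1 else 0
  | m + 1, 0 => connCoeff d m 1 * (1 / ((d : ℝ) + 1))
  -- The case n = 0 encodes x · c_0 = c_1; for d = 1 the fraction would be 0 / 0, which evaluates to
  -- 0.
  | m + 1, n + 1 => connCoeff d m n * (if n = 0 then 1 else ((n : ℝ) + d - 1) / (2 * n + d - 1)) +
      connCoeff d m (n + 2) * (((n : ℝ) + 2) / (2 * n + d + 3))

theorem connCoeff_nonneg {d : ℕ} (hd : 1 ≤ d) (m n : ℕ) : 0 ≤ connCoeff d m n := by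
  have hd' : (0 : ℝ) ≤ (d : ℝ) - 1 := by
    have : (1 : ℝ) ≤ d := by exact_mod_cast hd
    linarith
  induction m generalizing n with
  | zero => simp only [connCoeff]; split_ifs <;> norm_num
  | succ m ih =>
    cases n with
    | zero => have := ih 1; simp only [connCoeff]; positivity
    | succ n =>
      have h1 := ih n
      have h2 := ih (n + 2)
      have h3 : 0 ≤ (if n = 0 then (1 : ℝ) else ((n : ℝ) + d - 1) / (2 * n + d - 1)) := by
        split_ifs
        · norm_num
        · rw [add_sub_assoc, add_sub_assoc]; positivity
      simp only [connCoeff]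
      positivity

theorem connCoeff_eq_zero (d : ℕ) {m n : ℕ} (h : m < n) : connCoeff d m n = 0 := by
  induction m generalizing n with
  | zero => simp only [connCoeff, if_neg (show n ≠ 0 by omega)]
  | succ m ih =>
    obtain ⟨n, rfl⟩ := Nat.exists_eq_succ_of_ne_zero (show n ≠ 0 by omega)
    simp only [connCoeff, ih (show m < n by omega), ih (show m < n + 2 by omega)]
    simp

theorem X_mul_ultraPoly {d : ℕ} (hd : 1 ≤ d) (n : ℕ) (x : ℝ) :
    x * (ultraPoly d (n + 1)).eval x =
      ((n + 1 : ℕ) + (d : ℝ) - 1) / (2 * (n + 1 : ℕ) + d - 1) * (ultraPoly d (n + 2)).eval x +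
        ((n : ℝ) + 1) / (2 * n + d + 1) * (ultraPoly d n).eval x := by
  have h : 2 * (n : ℝ) + d + 1 ≠ 0 := by positivity
  have hr := ultraPoly_rec_eval hd n x
  push_cast
  rw [show 2 * ((n : ℝ) + 1) + d - 1 = 2 * n + d + 1 by ring,
    show (n : ℝ) + 1 + d - 1 = n + d by ring]
  field_simp
  linear_combination -hr

theorem pow_eq_sum_connCoeff {d : ℕ} (hd : 1 ≤ d) (m : ℕ) (x : ℝ) :
    ∀ K, m < K → x ^ m = ∑ n ∈ Finset.range K, connCoeff d m n * (ultraPoly d n).eval x := by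
  induction m with
  | zero =>
    intro K hK
    rw [Finset.sum_eq_single 0]
    · simp [connCoeff, ultraPoly]
    · intro n _ hn
      simp [connCoeff, hn]
    · simp; omega
  | succ m ih =>
    intro K hK
    obtain ⟨K, rfl⟩ := Nat.exists_eq_succ_of_ne_zero (show K ≠ 0 by omega)
    obtain ⟨L, rfl⟩ := Nat.exists_eq_succ_of_ne_zero (show K ≠ 0 by omega)
    have hz : ∀ j, connCoeff d m (L + 1 + j) = 0 := fun j => connCoeff_eq_zero d (by omega)
    set P := fun n => (ultraPoly d n).eval x with hP
    set p : ℕ → ℝ := fun n => if n = 0 then 1 else ((n : ℝ) + d - 1) / (2 * n + d - 1) with hp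
    have e0 : ∀ n, x * P n = p n * P (n + 1) +
        (if n = 0 then 0 else (n : ℝ) / (2 * n + d - 1) * P (n - 1)) := by
      intro n
      cases n with
      | zero => simp [hP, hp, ultraPoly]
      | succ n =>
        have := X_mul_ultraPoly hd n x
        simp only [hP, hp, Nat.add_eq_zero_iff, one_ne_zero, and_false, if_false,
          Nat.add_sub_cancel]
        rw [this]
        push_cast
        ring_nf
    calc x ^ (m + 1) = ∑ n ∈ Finset.range (L + 1), connCoeff d m n * (x * P n) := by
          rw [pow_succ, ih (L + 1) (by omega), Finset.sum_mul]
          exact Finset.sum_congr rfl fun n _ => by ring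
      _ = ∑ n ∈ Finset.range (L + 1), connCoeff d m n * p n * P (n + 1) +
            ∑ n ∈ Finset.range (L + 1), connCoeff d m n *
              (if n = 0 then 0 else (n : ℝ) / (2 * n + d - 1) * P (n - 1)) := by
          rw [← Finset.sum_add_distrib]
          exact Finset.sum_congr rfl fun n _ => by rw [e0]; ring
      _ = ∑ n ∈ Finset.range (L + 1), connCoeff d m n * p n * P (n + 1) +
            -- Two vanishing terms are added so that the shift n - 1 lines up with the target range.
            ∑ n ∈ Finset.range (L + 1 + 2), connCoeff d m n *
              (if n = 0 then 0 else (n : ℝ) / (2 * n + d - 1) * P (n - 1)) := by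
          rw [Finset.sum_range_succ _ (L + 1 + 1), Finset.sum_range_succ _ (L + 1)]
          rw [show connCoeff d m (L + 1) = 0 from hz 0, hz 1]
          ring
      _ = ∑ n ∈ Finset.range (L + 1 + 1), connCoeff d (m + 1) n * P n := by
          rw [Finset.sum_range_succ' _ (L + 1), Finset.sum_range_succ' _ (L + 1 + 1),
            Finset.sum_range_succ' _ (L + 1)]
          simp only [connCoeff, Nat.add_eq_zero_iff, one_ne_zero, and_false, if_false, if_true,
            Nat.add_sub_cancel, mul_zero, add_zero, add_mul, Finset.sum_add_distrib, hp]
          rw [add_assoc]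
          congr 1
          congr 1
          · refine Finset.sum_congr rfl fun n _ => ?_
            rw [mul_assoc]
            congr 2
            push_cast
            ring_nf
          · push_cast
            rw [mul_assoc]
            congr 2
            ring_nf

theorem sum_connCoeff {d : ℕ} (hd : 1 ≤ d) (m : ℕ) :
    ∑ n ∈ Finset.range (m + 1), connCoeff d m n = 1 := by
  have := pow_eq_sum_connCoeff hd m 1 (m + 1) (Nat.lt_succ_self m)
  simpa [ultraPoly_eval_one hd] using this.symm

theorem connCoeff_le_one {d : ℕ} (hd : 1 ≤ d) (m n : ℕ) : connCoeff d m n ≤ 1 := by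
  rcases lt_or_ge m n with h | h
  · rw [connCoeff_eq_zero d h]; norm_num
  · rw [← sum_connCoeff hd m]
    exact Finset.single_le_sum (f := fun n => connCoeff d m n) (fun _ _ => connCoeff_nonneg hd m _)
      (Finset.mem_range.2 (Nat.lt_succ_of_le h))

theorem tendsto_const_div_natCast_add (a b : ℝ) :
    Filter.Tendsto (fun d : ℕ => a / ((d : ℝ) + b)) Filter.atTop (nhds 0) :=
  Filter.Tendsto.const_div_atTop
    (Filter.tendsto_atTop_add_const_right _ b tendsto_natCast_atTop_atTop) a

/-- In the recurrence for x · c_n the upward weight tends to 1 and the downward weight to 0 as d →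
∞. -/
theorem tendsto_connCoeff (m n : ℕ) :
    Filter.Tendsto (fun d => connCoeff d m n) Filter.atTop (nhds (if n = m then 1 else 0)) := by
  induction m generalizing n with
  | zero => simp only [connCoeff]; exact tendsto_const_nhds
  | succ m ih =>
    cases n with
    | zero =>
      have := (ih 1).mul (tendsto_const_div_natCast_add 1 1)
      simpa [connCoeff] using this
    | succ n =>
      have h1 : Filter.Tendsto (fun d : ℕ => if n = 0 then (1 : ℝ) else
          ((n : ℝ) + d - 1) / (2 * n + d - 1)) Filter.atTop (nhds 1) := by
        split_ifs with h
        · exact tendsto_const_nhds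
        · have h2 := (tendsto_const_div_natCast_add n (2 * n - 1)).const_sub 1
          rw [sub_zero] at h2
          refine h2.congr fun d => ?_
          have hn : (1 : ℝ) ≤ n := by exact_mod_cast Nat.one_le_iff_ne_zero.2 h
          have hne : (d : ℝ) + (2 * n - 1) ≠ 0 := by
            have : (0 : ℝ) ≤ d := Nat.cast_nonneg d
            linarith
          rw [show 2 * (n : ℝ) + d - 1 = d + (2 * n - 1) by ring]
          rw [one_sub_div hne]
          congr 1
          ring
      have h3 : Filter.Tendsto (fun d : ℕ => ((n : ℝ) + 2) / (2 * n + d + 3)) Filter.atTop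
          (nhds 0) := by
        refine (tendsto_const_div_natCast_add ((n : ℝ) + 2) (2 * n + 3)).congr fun d => ?_
        congr 1
        ring
      have := ((ih n).mul h1).add ((ih (n + 2)).mul h3)
      simpa [connCoeff] using this

variable {G : Type*} [Group G] [TopologicalSpace G]

/-- The `d`-Schoenberg functions obtained by expanding the powers in a power expansion. -/
def schoenbergOfPower (φ : ℕ → G → ℂ) (d n : ℕ) (u : G) : ℂ :=
  ∑' m, φ m u * (connCoeff d m n : ℂ)

theorem norm_mul_connCoeff_le {φ : ℕ → G → ℂ} (hφ : ∀ n, φ n ∈ PosDefFun G) {d : ℕ} (hd : 1 ≤ d)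
    (m n : ℕ) (u : G) : ‖φ m u * (connCoeff d m n : ℂ)‖ ≤ ‖φ m 1‖ := by
  rw [norm_mul, Complex.norm_real, Real.norm_of_nonneg (connCoeff_nonneg hd m n)]
  exact (mul_le_of_le_one_right (norm_nonneg _) (connCoeff_le_one hd m n)).trans
    (IsPosDef.norm_le (hφ m).2 u)

/-- The double series is dominated by ‖φ_m(1)‖ `connCoeff d m n`, whose rows sum to ‖φ_m(1)‖, so the
order of summation may be exchanged. -/
theorem isSchoenbergSeq_schoenbergOfPower {f : ℝ × G → ℂ} {φ : ℕ → G → ℂ}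
    (h : IsPowerExpansion f φ) {d : ℕ} (hd : 1 ≤ d) :
    IsSchoenbergSeq d f (schoenbergOfPower φ d) := by
  obtain ⟨hφ, hs, hsum⟩ := h
  have hdouble : ∀ (x : ℝ), x ∈ Set.Icc (-1 : ℝ) 1 → ∀ (u : G) (z : ℂ),
      HasSum (fun m => φ m u * (x : ℂ) ^ m) z →
      HasSum (fun n => schoenbergOfPower φ d n u * (((ultraPoly d n).eval x : ℝ) : ℂ)) z := by
    intro x hx u z hz
    set F : ℕ × ℕ → ℂ := fun q => φ q.1 u * (connCoeff d q.1 q.2 : ℂ) *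
      (((ultraPoly d q.2).eval x : ℝ) : ℂ) with hF
    set b : ℕ × ℕ → ℝ := fun q => ‖φ q.1 1‖ * connCoeff d q.1 q.2 with hb
    have hb0 : 0 ≤ b := fun q => mul_nonneg (norm_nonneg _) (connCoeff_nonneg hd _ _)
    have hrow : ∀ m, HasSum (fun n => connCoeff d m n) 1 := by
      intro m
      have := hasSum_sum_of_ne_finset_zero (L := .unconditional ℕ) (s := Finset.range (m + 1))
        (f := fun n => connCoeff d m n) fun n hn =>
          connCoeff_eq_zero d (by simp only [Finset.mem_range] at hn; omega)
      rwa [sum_connCoeff hd m] at this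
    have hbs : Summable b := by
      rw [summable_prod_of_nonneg hb0]
      refine ⟨fun m => ((hrow m).mul_left ‖φ m 1‖).summable, ?_⟩
      have : (fun m => ∑' n, b (m, n)) = fun m => ‖φ m 1‖ := by
        funext m
        have := ((hrow m).mul_left ‖φ m 1‖).tsum_eq
        rwa [mul_one] at this
      rw [this]
      exact hs.norm
    have hFb : ∀ q, ‖F q‖ ≤ b q := by
      intro q
      rw [hF, norm_mul, norm_mul, Complex.norm_real, Complex.norm_real,
        Real.norm_of_nonneg (connCoeff_nonneg hd _ _), Real.norm_eq_abs]
      exact (mul_le_of_le_one_right (mul_nonneg (norm_nonneg _) (connCoeff_nonneg hd _ _))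
        (ultraPoly_abs_le hd _ hx)).trans
          (mul_le_mul_of_nonneg_right (IsPosDef.norm_le (hφ q.1).2 u) (connCoeff_nonneg hd _ _))
    have hFs : Summable F := Summable.of_norm_bounded hbs hFb
    have h1 : ∀ m, HasSum (fun n => F (m, n)) (φ m u * (x : ℂ) ^ m) := by
      intro m
      have := hasSum_sum_of_ne_finset_zero (L := .unconditional ℕ) (s := Finset.range (m + 1))
        (f := fun n => F (m, n)) fun n hn => by
          simp only [hF]
          rw [connCoeff_eq_zero d (by simp only [Finset.mem_range] at hn; omega)]
          simp
      convert this using 1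
      rw [← Complex.ofReal_pow, pow_eq_sum_connCoeff hd m x (m + 1) (Nat.lt_succ_self m)]
      push_cast
      rw [Finset.mul_sum]
      exact Finset.sum_congr rfl fun n _ => by simp only [hF]; ring
    have h2 := hFs.hasSum.prod_fiberwise h1
    have h3 := h2.unique hz
    have h4 : HasSum (fun q : ℕ × ℕ => F q.swap) z := by
      rw [← h3]
      exact (Equiv.prodComm ℕ ℕ).hasSum_iff.2 hFs.hasSum
    refine h4.prod_fiberwise fun n => ?_
    have h5 : Summable fun m => φ m u * (connCoeff d m n : ℂ) :=
      Summable.of_norm_bounded hs.norm fun m => norm_mul_connCoeff_le hφ hd m n u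
    exact h5.hasSum.mul_right _
  refine ⟨fun n => ?_, ?_, fun θ hθ u => ?_⟩
  · refine posDefFun_tsum (fun m => ⟨(hφ m).1.mul continuous_const,
      IsPosDef.mul_ofReal (hφ m).2 (connCoeff_nonneg hd m n)⟩) ?_
    exact Summable.of_norm_bounded hs.norm fun m => norm_mul_connCoeff_le hφ hd m n 1
  -- At x = 1 every c_n equals 1, so the expansion there is the required sum.
  · have := hdouble 1 (by simp) 1 (f (Real.cos 0, 1))
      (by simpa using hsum 0 ⟨le_rfl, Real.pi_pos.le⟩ 1)
    simpa [ultraPoly_eval_one hd] using this.summable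
  · simp only [ultraspherical_eq hd]
    exact hdouble _ ⟨Real.neg_one_le_cos θ, Real.cos_le_one θ⟩ u _ (hsum θ hθ u)

theorem IsSchoenbergSeq.unique {f : ℝ × G → ℂ} {d : ℕ} (hd : 1 ≤ d) {ψ ψ' : ℕ → G → ℂ}
    (h : IsSchoenbergSeq d f ψ) (h' : IsSchoenbergSeq d f ψ') : ψ = ψ' := by
  have hn : ∀ {χ : ℕ → G → ℂ}, IsSchoenbergSeq d f χ → ∀ u, Summable fun n => ‖χ n u‖ :=
    fun hχ u => Summable.of_nonneg_of_le (fun _ => norm_nonneg _)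
      (fun n => IsPosDef.norm_le (hχ.1 n).2 u) hχ.2.1.norm
  funext n u
  refine sub_eq_zero.1 (eq_zero_of_hasSum_ultraPoly hd (a := fun n => ψ n u - ψ' n u)
    (Summable.of_nonneg_of_le (fun _ => norm_nonneg _) (fun n => norm_sub_le _ _)
      ((hn h u).add (hn h' u))) (fun θ hθ => ?_) n)
  have h1 := (h.2.2 θ hθ u).sub (h'.2.2 θ hθ u)
  simp only [ultraspherical_eq hd, sub_self, ← sub_mul] at h1
  exact h1

theorem tendsto_schoenbergOfPower {φ : ℕ → G → ℂ} (hφ : ∀ n, φ n ∈ PosDefFun G)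
    (hs : Summable fun n => φ n 1) (n : ℕ) (u : G) :
    Filter.Tendsto (fun d => schoenbergOfPower φ d n u) Filter.atTop (nhds (φ n u)) := by
  have h := tendsto_tsum_of_dominated_convergence (𝓕 := Filter.atTop) hs.norm
    (f := fun d m => φ m u * (connCoeff d m n : ℂ))
    (fun m => ((Complex.continuous_ofReal.tendsto _).comp (tendsto_connCoeff m n)).const_mul _)
    (by
      filter_upwards [Filter.eventually_ge_atTop 1] with d hd m
      exact norm_mul_connCoeff_le hφ hd m n u)
  have e : ∑' m, φ m u * (((if n = m then 1 else 0 : ℝ)) : ℂ) = φ n u := by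
    rw [tsum_eq_single n]
    · simp
    · intro m hm
      simp [hm.symm]
  rw [e] at h
  exact h

theorem IsPowerExpansion.tendstoUniformlyOn {f : ℝ × G → ℂ} {φ : ℕ → G → ℂ}
    (h : IsPowerExpansion f φ) :
    TendstoUniformlyOn
      (fun (N : ℕ) (p : ℝ × G) => ∑ n ∈ Finset.range N, φ n p.2 * (Real.cos p.1 : ℂ) ^ n)
      (fun p : ℝ × G => f (Real.cos p.1, p.2))
      Filter.atTop (Set.Icc 0 Real.pi ×ˢ Set.univ) := by
  refine (tendstoUniformlyOn_tsum_nat h.2.1.norm fun n p _ => ?_).congr_right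
    fun p hp => (h.2.2 p.1 hp.1 p.2).tsum_eq
  rw [norm_mul, norm_pow, Complex.norm_real, Real.norm_eq_abs]
  exact (mul_le_of_le_one_right (norm_nonneg _)
    (pow_le_one₀ (abs_nonneg _) (Real.abs_cos_le_one _))).trans (IsPosDef.norm_le (h.1 n).2 p.2)

end

end SchoenbergProduct

end

theorem theorem3p10 {G : Type*} [Group G] [TopologicalSpace G] [IsTopologicalGroup G]
    [LocallyCompactSpace G] (f : ℝ × G → ℂ)
    (hf : ContinuousOn f (Set.Icc (-1) 1 ×ˢ Set.univ)) :
    (f ∈ SchoenbergProduct.SphereInfPosDef G ↔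
      ∃ φ : ℕ → G → ℂ, SchoenbergProduct.IsPowerExpansion f φ) ∧
    ∀ φ : ℕ → G → ℂ, SchoenbergProduct.IsPowerExpansion f φ →
      TendstoUniformlyOn
        (fun (N : ℕ) (p : ℝ × G) =>
          ∑ n ∈ Finset.range N, φ n p.2 * (Real.cos p.1 : ℂ) ^ n)
        (fun p : ℝ × G => f (Real.cos p.1, p.2))
        Filter.atTop (Set.Icc 0 Real.pi ×ˢ Set.univ) ∧
      (∀ d : ℕ, 1 ≤ d → ∃! ψ : ℕ → G → ℂ, SchoenbergProduct.IsSchoenbergSeq d f ψ) ∧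
      ∀ ψ : ℕ → ℕ → G → ℂ,
        (∀ d : ℕ, 1 ≤ d → SchoenbergProduct.IsSchoenbergSeq d f (ψ d)) →
          ∀ (n : ℕ) (u : G),
            Filter.Tendsto (fun d : ℕ => ψ d n u) Filter.atTop (nhds (φ n u)) := by
  refine ⟨⟨SchoenbergProduct.exists_isPowerExpansion, fun ⟨φ, hφ⟩ => hφ.mem_sphereInfPosDef hf⟩,
    fun φ hφ => ⟨hφ.tendstoUniformlyOn, fun d hd =>
      ⟨_, SchoenbergProduct.isSchoenbergSeq_schoenbergOfPower hφ hd, fun ψ hψ =>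
        SchoenbergProduct.IsSchoenbergSeq.unique hd hψ
          (SchoenbergProduct.isSchoenbergSeq_schoenbergOfPower hφ hd)⟩, fun ψ hψ n u => ?_⟩⟩
  -- By uniqueness any Schoenberg sequence is the explicit one for d ≥ 1; the value at d = 0 is
  -- irrelevant to the limit.
  refine (SchoenbergProduct.tendsto_schoenbergOfPower hφ.1 hφ.2.1 n u).congr' ?_
  filter_upwards [Filter.eventually_ge_atTop 1] with d hd
  rw [SchoenbergProduct.IsSchoenbergSeq.unique hd (hψ d hd)
    (SchoenbergProduct.isSchoenbergSeq_schoenbergOfPower hφ hd)]
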